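/- **Setting.** Let $P$ be a poset. Let $\mathcal U$ and $\mathcal D$ be a join- and a meet-specification of $P$ of radius at most $\omega$: each is a set of finite subsets of $P$ that contains all singletons, every $S\in\mathcal U$ has a join in $P$, and every $S\in\mathcal D$ has a meet in $P$. For a poset $A$ with sets $\mathcal U,\mathcal D$ of subsets of $A$, a $\mathcal U$-ideal is a downset closed under existing joins of members of $\mathcal U$, and a $\mathcal D$-filter is an upset closed under existing meets of members of $\mathcal D$; such a set is finitely generated if it is the smallest $\mathcal U$-ideal (resp. $\mathcal D$-filter) containing some finite set. Given a meet-extension $e_X:A\to X$ (an order-embedding with $x=\bigwedge e_X[e_X^{-1}(x^\uparrow)]$ for all $x$) and a join-extension $e_Y:A\to Y$ (defined dually), their *canonical amalgamation* is the poset $\mathcal A_{(e_X,e_Y)}$ (unique up to isomorphism) with a completely meet-preserving order-embedding $\pi_X:X\to\mathcal A_{(e_X,e_Y)}$ and a completely join-preserving order-embedding $\pi_Y:Y\to\mathcal A_{(e_X,e_Y)}$ with $\pi_X\circ e_X=\pi_Y\circ e_Y$, such that for every poset $Q$ and all order-preserving $f:X\to Q$, $g:Y\to Q$ with $f\circ e_X=g\circ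 e_Y$ and $\pi_Y(y)\le\pi_X(x)\Rightarrow g(y)\le f(x)$, there is a unique order-preserving $u$ with $u\circ\pi_X=f$ and $u\circ\pi_Y=g$. Concretely, it is the partial order induced by the quasiorder on the disjoint union of $X$ and $Y$ that extends the orders of $X$ and $Y$ and has $x\preceq y$ iff $x\le e_X(p)$ and $e_Y(p)\le y$ for some $p\in A$, and $y\preceq x$ iff $p\le q$ whenever $e_Y(p)\le y$ and $x\le e_X(q)$. Put $\mathcal A_0=P$, $\mathcal U_0=\mathcal U$, $\mathcal D_0=\mathcal D$. Given $(\mathcal A_n,\mathcal U_n,\mathcal D_n)$, let $X_n$ be the set of non-empty finitely generated $\mathcal D_n$-filters of $\mathcal A_n$ ordered by reverse inclusion, $Y_n$ the set of non-empty finitely generated $\mathcal U_n$-ideals ordered by inclusion, $e_{X_n}(p)=p^\uparrow$ and $e_{Y_n}(p)=p^\downarrow$. Let $\mathcal A_{n+1}$ be the canonical amalgamation of $e_{X_n}$ and $e_{Y_n}$, let $\gamma_n=\pi_{X_n}\circ e_{X_n}=\pi_{Y_n}\circ e_{Y_n}:\mathcal A_n\to\mathcal A_{n+1}$, and let $\mathcal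 U_{n+1}=\mathcal D_{n+1}$ be the set of non-empty finite subsets of $\gamma_n[\mathcal A_n]$. Let $\gamma_{0n}=\gamma_{n-1}\circ\cdots\circ\gamma_0:P\to\mathcal A_n$ (with $\gamma_{00}=\mathrm{id}$). Let $(\mathcal A,(\mu_n:\mathcal A_n\to\mathcal A)_{n\in\omega})$ be a colimit of the chain $\mathcal A_0\to\mathcal A_1\to\cdots$ in the category of posets and order-embeddings. For a subset $T$ of a poset $Q$, $T$-terms are built from the elements of $T$ by formal $k$-ary joins $\bigvee_k$ and meets $\bigwedge_k$, $2\le k<\omega$. Elements of $T$ have complexity $0$, and $\bigvee_k(\phi_1,\dots,\phi_k)$ and $\bigwedge_k(\phi_1,\dots,\phi_k)$ have complexity $1+\max_i(\text{complexity of }\phi_i)$. An element $q\in Q$ corresponds to the term $t\in T$ iff $q=t$; it corresponds to $\bigvee_k(\phi_1,\dots,\phi_k)$ (resp. $\bigwedge_k$) iff there are $q_1,\dots,q_k\in Q$ with $q_i$ corresponding to $\phi_i$ such that $q$ is the join (resp. meet) of $\{q_1,\dots,q_k\}$ in $Q$. For $k\in\omega\cup\{\omega\}$, $Q$ is $k$-complete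 relative to $T$ if every $T$-term of complexity less than $k$ has a corresponding element in $Q$. The rank $\mathrm{rank}_T(q)$ is the least complexity of a $T$-term to which $q$ corresponds, and is undefined if there is none. **Proposition.** Let $1\le n<\omega$. Then: 1. For every $q\in\mathcal A_n$, $\mathrm{rank}_{\gamma_{0n}[P]}(q)$ is defined and is at most $n$. 2. $\mathcal A_n$ is $(n+1)$-complete relative to $\gamma_{0n}[P]$. 3. For every $q\in\mathcal A$, $\mathrm{rank}_{\mu_0[P]}(q)$ is defined (finite). 4. $\mathcal A$ is $\omega$-complete relative to $\mu_0[P]$. 5. For every $q\in\mathcal A$ and $m\in\omega$: $\mathrm{rank}_{\mu_0[P]}(q)=m$ if and only if $m$ is the smallest number such that there is $q'\in\mathcal A_m$ with $\mu_m(q')=q$. -/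

import Mathlib

universe u

namespace FreeLat

/-! ### Extensions, specifications, ideals and filters -/

/-- `e : P → X` is a meet-extension: every `x` is the meet of the images of the elements of `P`
that lie above it. -/
def IsMeetExtension {P X : Type u} [PartialOrder P] [PartialOrder X] (e : P ↪o X) : Prop :=
  ∀ x : X, IsGLB (e '' (e ⁻¹' Set.Ici x)) x

/-- `e : P → Y` is a join-extension: every `y` is the join of the images of the elements of `P`
that lie below it. -/
def IsJoinExtension {P Y : Type u} [PartialOrder P] [PartialOrder Y] (e : P ↪o Y) : Prop :=
  ∀ y : Y, IsLUB (e '' (e ⁻¹' Set.Iic y)) y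

/-- Join-specifications of `P`. -/
def IsJoinSpec {P : Type u} [PartialOrder P] (U : Set (Set P)) : Prop :=
  (∀ S ∈ U, ∃ a, IsLUB S a) ∧ ∀ p : P, {p} ∈ U

/-- Meet-specifications of `P`. -/
def IsMeetSpec {P : Type u} [PartialOrder P] (D : Set (Set P)) : Prop :=
  (∀ S ∈ D, ∃ a, IsGLB S a) ∧ ∀ p : P, {p} ∈ D

/-- The radius of `U` is at most `ω`: every member of `U` has cardinality less than `ω`. -/
def RadiusLeOmega {P : Type u} (U : Set (Set P)) : Prop :=
  ∀ S ∈ U, S.Finite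

/-- `U`-ideals: downsets closed under the joins of members of `U`. -/
def IsUIdeal {P : Type u} [PartialOrder P] (U : Set (Set P)) (I : Set P) : Prop :=
  IsLowerSet I ∧ ∀ S ∈ U, S ⊆ I → ∀ a, IsLUB S a → a ∈ I

/-- `D`-filters: upsets closed under the meets of members of `D`. -/
def IsDFilter {P : Type u} [PartialOrder P] (D : Set (Set P)) (F : Set P) : Prop :=
  IsUpperSet F ∧ ∀ S ∈ D, S ⊆ F → ∀ a, IsGLB S a → a ∈ F

/-- `I` is the smallest `U`-ideal containing some finite set. -/
def IsFGIdeal {P : Type u} [PartialOrder P] (U : Set (Set P)) (I : Set P) : Prop :=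
  ∃ S : Set P, S.Finite ∧ IsLeast {J | IsUIdeal U J ∧ S ⊆ J} I

/-- `F` is the smallest `D`-filter containing some finite set. -/
def IsFGFilter {P : Type u} [PartialOrder P] (D : Set (Set P)) (F : Set P) : Prop :=
  ∃ S : Set P, S.Finite ∧ IsLeast {J | IsDFilter D J ∧ S ⊆ J} F

/-- The set of non-empty finitely generated `U`-ideals. -/
structure FGIdeal {P : Type u} [PartialOrder P] (U : Set (Set P)) : Type u where
  carrier : Set P
  nonempty : carrier.Nonempty
  fg : IsFGIdeal U carrier

/-- The set of non-empty finitely generated `D`-filters. -/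
structure FGFilter {P : Type u} [PartialOrder P] (D : Set (Set P)) : Type u where
  carrier : Set P
  nonempty : carrier.Nonempty
  fg : IsFGFilter D carrier

/-- Ideals are ordered by inclusion. -/
instance {P : Type u} [PartialOrder P] (U : Set (Set P)) : PartialOrder (FGIdeal U) where
  le I J := I.carrier ⊆ J.carrier
  le_refl _ := subset_rfl
  le_trans _ _ _ h k := h.trans k
  le_antisymm := by
    rintro ⟨I, _, _⟩ ⟨J, _, _⟩ h k
    congr
    exact Set.Subset.antisymm h k

/-- Filters are ordered by reverse inclusion. -/
instance {P : Type u} [PartialOrder P] (D : Set (Set P)) : PartialOrder (FGFilter D) where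
  le F G := G.carrier ⊆ F.carrier
  le_refl _ := subset_rfl
  le_trans _ _ _ h k := k.trans h
  le_antisymm := by
    rintro ⟨I, _, _⟩ ⟨J, _, _⟩ h k
    congr
    exact Set.Subset.antisymm k h

theorem isFGIdeal_Iic {P : Type u} [PartialOrder P] (U : Set (Set P)) (p : P) :
    IsFGIdeal U (Set.Iic p) := by
  refine ⟨{p}, Set.finite_singleton p, ⟨⟨isLowerSet_Iic p, ?_⟩, by simp⟩, ?_⟩
  · intro S _ hS a ha
    exact ha.2 hS
  · rintro J ⟨hJ, hp⟩ q hq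
    exact hJ.1 hq (hp rfl)

theorem isFGFilter_Ici {P : Type u} [PartialOrder P] (D : Set (Set P)) (p : P) :
    IsFGFilter D (Set.Ici p) := by
  refine ⟨{p}, Set.finite_singleton p, ⟨⟨isUpperSet_Ici p, ?_⟩, by simp⟩, ?_⟩
  · intro S _ hS a ha
    exact ha.2 hS
  · rintro J ⟨hJ, hp⟩ q hq
    exact hJ.1 hq (hp rfl)

/-- The join-extension `e_Y : p ↦ p↓`. -/
def eY {P : Type u} [PartialOrder P] (U : Set (Set P)) : P ↪o FGIdeal U where
  toFun p := ⟨Set.Iic p, ⟨p, le_rfl⟩, isFGIdeal_Iic U p⟩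
  inj' _ _ h := Set.Iic_injective (congrArg FGIdeal.carrier h)
  map_rel_iff' := Set.Iic_subset_Iic

/-- The meet-extension `e_X : p ↦ p↑`. -/
def eX {P : Type u} [PartialOrder P] (D : Set (Set P)) : P ↪o FGFilter D where
  toFun p := ⟨Set.Ici p, ⟨p, le_rfl⟩, isFGFilter_Ici D p⟩
  inj' _ _ h := Set.Ici_injective (congrArg FGFilter.carrier h)
  map_rel_iff' := Set.Ici_subset_Ici

theorem isJoinExtension_eY {P : Type u} [PartialOrder P] (U : Set (Set P)) :
    IsJoinExtension (eY U) := by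
  intro y
  refine ⟨?_, ?_⟩
  · rintro _ ⟨p, hp, rfl⟩
    exact hp
  · intro z hz p hp
    obtain ⟨S, _, hl⟩ := y.fg
    have h : eY U p ≤ z := hz ⟨p, fun q hq => hl.1.1.1 hq hp, rfl⟩
    exact h (show p ≤ p from le_rfl)

theorem isMeetExtension_eX {P : Type u} [PartialOrder P] (D : Set (Set P)) :
    IsMeetExtension (eX D) := by
  intro y
  refine ⟨?_, ?_⟩
  · rintro _ ⟨p, hp, rfl⟩
    exact hp
  · intro z hz p hp
    obtain ⟨S, _, hl⟩ := y.fg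
    have h : z ≤ eX D p := hz ⟨p, fun q hq => hl.1.1.1 hq hp, rfl⟩
    exact h (show p ≤ p from le_rfl)

/-! ### Canonical amalgamations -/

/-- A canonical amalgamation of `iX : P → X` and `iY : P → Y`. -/
structure CanonicalAmalgamation {P X Y : Type u} [PartialOrder P] [PartialOrder X]
    [PartialOrder Y] (iX : P ↪o X) (iY : P ↪o Y) : Type (u + 1) where
  carrier : Type u
  [ord : PartialOrder carrier]
  piX : X ↪o carrier
  piY : Y ↪o carrier
  /-- `piX` is completely meet-preserving -/
  map_isGLB : ∀ (S : Set X) (x : X), IsGLB S x → IsGLB (piX '' S) (piX x)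
  /-- `piY` is completely join-preserving -/
  map_isLUB : ∀ (S : Set Y) (y : Y), IsLUB S y → IsLUB (piY '' S) (piY y)
  comm : ∀ p, piX (iX p) = piY (iY p)
  /-- the universal property -/
  univ : ∀ (Q : Type u) [PartialOrder Q] (f : X →o Q) (g : Y →o Q),
    (∀ p, f (iX p) = g (iY p)) → (∀ x y, piY y ≤ piX x → g y ≤ f x) →
      ∃! h : carrier →o Q, (∀ x, h (piX x) = f x) ∧ ∀ y, h (piY y) = g y

attribute [instance] CanonicalAmalgamation.ord

/-- The map `γ = π_X ∘ e_X = π_Y ∘ e_Y`. -/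
def CanonicalAmalgamation.gamma {P X Y : Type u} [PartialOrder P] [PartialOrder X]
    [PartialOrder Y] {iX : P ↪o X} {iY : P ↪o Y} (A : CanonicalAmalgamation iX iY) :
    P ↪o A.carrier :=
  iX.trans A.piX

section Uplus

variable {P X Y : Type u} [PartialOrder P] [PartialOrder X] [PartialOrder Y]
  {iX : P ↪o X} {iY : P ↪o Y}

/-- The disjoint union of `X` and `Y`, to carry the quasiorder of the Galois polarity
`(e_X, e_Y, R_l)`, where `x R_l y` iff some `p` has `x ≤ e_X p` and `e_Y p ≤ y`. -/
def Glue (_hX : IsMeetExtension iX) (_hY : IsJoinExtension iY) : Type u := X ⊕ Y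

/-- The quasiorder on the disjoint union. -/
def glueLE (iX : P ↪o X) (iY : P ↪o Y) : X ⊕ Y → X ⊕ Y → Prop
  | .inl x, .inl x' => x ≤ x'
  | .inr y, .inr y' => y ≤ y'
  | .inl x, .inr y => ∃ p, x ≤ iX p ∧ iY p ≤ y
  | .inr y, .inl x => ∀ p q, iY p ≤ y → x ≤ iX q → p ≤ q

instance (hX : IsMeetExtension iX) (hY : IsJoinExtension iY) : Preorder (Glue hX hY) where
  le := glueLE iX iY
  le_refl a := by
    rcases a with x | y
    · exact le_refl x
    · exact le_refl y
  le_trans a b c hab hbc := by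
    rcases a with x | y <;> rcases b with x' | y' <;> rcases c with x'' | y'' <;>
      simp only [glueLE] at hab hbc ⊢
    · exact hab.trans hbc
    · obtain ⟨p, h, k⟩ := hbc
      exact ⟨p, hab.trans h, k⟩
    · obtain ⟨p, h, k⟩ := hab
      refine h.trans ((hX x'').2 ?_)
      rintro _ ⟨q, hq, rfl⟩
      exact iX.monotone (hbc p q k hq)
    · obtain ⟨p, h, k⟩ := hab
      exact ⟨p, h, k.trans hbc⟩
    · intro p q hp hq
      exact hab p q hp (hbc.trans hq)
    · obtain ⟨p, h, k⟩ := hbc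
      refine ((hY y).2 ?_).trans k
      rintro _ ⟨q, hq, rfl⟩
      exact iY.monotone (hab q p hq h)
    · intro p q hp hq
      exact hbc p q (hp.trans hab) hq
    · exact hab.trans hbc

/-- The poset `X ⊎ Y` with its two inclusions, as a canonical amalgamation. -/
def uplus (hX : IsMeetExtension iX) (hY : IsJoinExtension iY) :
    CanonicalAmalgamation iX iY where
  carrier := Antisymmetrization (Glue hX hY) (· ≤ ·)
  piX := OrderEmbedding.ofMapLEIff
    (fun x => toAntisymmetrization (α := Glue hX hY) (· ≤ ·) (Sum.inl x)) fun _ _ => Iff.rfl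
  piY := OrderEmbedding.ofMapLEIff
    (fun y => toAntisymmetrization (α := Glue hX hY) (· ≤ ·) (Sum.inr y)) fun _ _ => Iff.rfl
  map_isGLB S x hx := by
    refine ⟨?_, ?_⟩
    · rintro _ ⟨s, hs, rfl⟩
      exact hx.1 hs
    · intro b hb
      induction b using Quotient.inductionOn with | _ b
      rcases b with z | y
      · refine (hx.2 fun s hs => ?_ : z ≤ x)
        exact (hb ⟨s, hs, rfl⟩ :)
      · refine (fun p q hp hq => ?_ : ∀ p q, iY p ≤ y → x ≤ iX q → p ≤ q)
        refine iX.le_iff_le.1 (le_trans (hx.2 fun s hs => (hX s).2 ?_) hq)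
        rintro _ ⟨r, hr, rfl⟩
        have h : ∀ p q, iY p ≤ y → s ≤ iX q → p ≤ q := hb ⟨s, hs, rfl⟩
        exact iX.monotone (h p r hp hr)
  map_isLUB S y hy := by
    refine ⟨?_, ?_⟩
    · rintro _ ⟨s, hs, rfl⟩
      exact hy.1 hs
    · intro b hb
      induction b using Quotient.inductionOn with | _ b
      rcases b with x | z
      · refine (fun p q hp hq => ?_ : ∀ p q, iY p ≤ y → x ≤ iX q → p ≤ q)
        refine iY.le_iff_le.1 (le_trans hp (hy.2 fun s hs => (hY s).2 ?_))
        rintro _ ⟨r, hr, rfl⟩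
        have h : ∀ p q, iY p ≤ s → x ≤ iX q → p ≤ q := hb ⟨s, hs, rfl⟩
        exact iY.monotone (h r q hr hq)
      · refine (hy.2 fun s hs => ?_ : y ≤ z)
        exact (hb ⟨s, hs, rfl⟩ :)
  comm p := by
    refine le_antisymm ?_ ?_
    · exact (⟨p, le_rfl, le_rfl⟩ : ∃ q, iX p ≤ iX q ∧ iY q ≤ iY p)
    · exact (fun a b ha hb => (iY.le_iff_le.1 ha).trans (iX.le_iff_le.1 hb) :
        ∀ a b, iY a ≤ iY p → iX p ≤ iX b → a ≤ b)
  univ Q _ f g hfg hle := by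
    have key : ∀ a b : Glue hX hY, a ≤ b → Sum.elim f g a ≤ Sum.elim f g b := by
      rintro (x | y) (x' | y') hab
      · exact f.monotone hab
      · obtain ⟨p, h, k⟩ : ∃ p, x ≤ iX p ∧ iY p ≤ y' := hab
        exact (f.monotone h).trans ((hfg p).le.trans (g.monotone k))
      · exact hle x' y hab
      · exact g.monotone hab
    refine ⟨⟨Quotient.lift (Sum.elim f g : Glue hX hY → Q) ?_, ?_⟩, ⟨fun _ => rfl, fun _ => rfl⟩, ?_⟩
    · intro a b hab
      exact le_antisymm (key a b hab.1) (key b a hab.2)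
    · intro a b hab
      induction a using Quotient.inductionOn
      induction b using Quotient.inductionOn
      exact key _ _ hab
    · rintro h ⟨h1, h2⟩
      ext a
      induction a using Quotient.inductionOn with | _ a
      rcases a with x | y
      · exact h1 x
      · exact h2 y

end Uplus

/-! ### The chain of canonical amalgamations -/

/-- A poset together with two families of subsets (of joins and of meets to be preserved). -/
structure SpecPoset : Type (u + 1) where
  carrier : Type u
  [ord : PartialOrder carrier]
  U : Set (Set carrier)
  D : Set (Set carrier)

attribute [instance] SpecPoset.ord

/-- The canonical amalgamation of the extensions of a poset by its non-empty finitely generated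
`D`-filters and `U`-ideals. -/
def SpecPoset.amalg (A : SpecPoset.{u}) : CanonicalAmalgamation (eX A.D) (eY A.U) :=
  uplus (isMeetExtension_eX A.D) (isJoinExtension_eY A.U)

/-- The next step of the chain: the canonical amalgamation, in which both specifications are the
set of non-empty finite subsets of the image of `γ`. -/
def SpecPoset.next (A : SpecPoset.{u}) : SpecPoset.{u} where
  carrier := A.amalg.carrier
  U := {S | S.Nonempty ∧ S.Finite ∧ S ⊆ Set.range A.amalg.gamma}
  D := {S | S.Nonempty ∧ S.Finite ∧ S ⊆ Set.range A.amalg.gamma}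

section Chain

variable {P : Type u} [PartialOrder P] (U D : Set (Set P))

/-- The poset `A_n` with its specifications `U_n` and `D_n`. -/
def stage : ℕ → SpecPoset.{u}
  | 0 => { carrier := P, U := U, D := D }
  | n + 1 => (stage n).next

/-- The poset `A_n`. -/
abbrev Approx (n : ℕ) : Type u := (stage U D n).carrier

/-- The map `γ_n : A_n → A_{n+1}`. -/
def gamma (n : ℕ) : Approx U D n ↪o Approx U D (n + 1) := (stage U D n).amalg.gamma

/-- The map `γ_{0n} = γ_{n-1} ∘ ⋯ ∘ γ_0 : P → A_n`. -/
def gammaZero : (n : ℕ) → P ↪o Approx U D n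
  | 0 => RelEmbedding.refl _
  | n + 1 => (gammaZero n).trans (gamma U D n)

end Chain

/-! ### The colimit of the chain, in the category of posets and order-embeddings -/

/-- Objects of the category of posets with order-embeddings. -/
structure PosE : Type (u + 1) where
  carrier : Type u
  [ord : PartialOrder carrier]

attribute [instance] PosE.ord

instance : CategoryTheory.Category PosE.{u} where
  Hom A B := A.carrier ↪o B.carrier
  id A := RelEmbedding.refl _
  comp f g := RelEmbedding.trans f g

section Colimit

variable {P : Type u} [PartialOrder P] (U D : Set (Set P))

/-- The functor `ω → Pos_e` with `n ↦ A_n`, sending `n ≤ n + 1` to `γ_n`. -/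
def chain : CategoryTheory.Functor ℕ PosE.{u} :=
  CategoryTheory.Functor.ofSequence (X := fun n => PosE.mk (Approx U D n)) (gamma U D)

variable {U D}

/-- The map `μ_n : A_n → A` of a cocone with vertex `A`. -/
def mu (c : CategoryTheory.Limits.Cocone (chain U D)) (n : ℕ) :
    Approx U D n ↪o c.pt.carrier :=
  c.ι.app n

end Colimit

/-! ### Terms, correspondents, relative completeness and rank -/

/-- `T`-terms, built from the elements of `T` with an `n`-ary join symbol and an `n`-ary meet
symbol for each `n ≥ 2`. -/
inductive LTerm (T : Type u) : Type u
  | var (t : T) : LTerm T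
  | join (n : ℕ) (hn : 2 ≤ n) (φ : Fin n → LTerm T) : LTerm T
  | meet (n : ℕ) (hn : 2 ≤ n) (φ : Fin n → LTerm T) : LTerm T

/-- The complexity of a term. -/
def LTerm.complexity {T : Type u} : LTerm T → ℕ
  | .var _ => 0
  | .join _ _ φ => (Finset.univ.sup fun i => (φ i).complexity) + 1
  | .meet _ _ φ => (Finset.univ.sup fun i => (φ i).complexity) + 1

/-- `Corresponds φ q`: the element `q` of `Q` is a correspondent for the `T`-term `φ`. -/
def Corresponds {Q : Type u} [PartialOrder Q] {T : Set Q} : LTerm T → Q → Prop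
  | .var t, q => q = t
  | .join n _ φ, q => ∃ r : Fin n → Q, (∀ i, Corresponds (φ i) (r i)) ∧ IsLUB (Set.range r) q
  | .meet n _ φ, q => ∃ r : Fin n → Q, (∀ i, Corresponds (φ i) (r i)) ∧ IsGLB (Set.range r) q

/-- `Q` is `k`-complete relative to `T`, for `k ∈ ω ∪ {ω}` (with `⊤` for `ω`). -/
def IsCompleteRelTo {Q : Type u} [PartialOrder Q] (k : ℕ∞) (T : Set Q) : Prop :=
  ∀ φ : LTerm T, (φ.complexity : ℕ∞) < k → ∃ q : Q, Corresponds φ q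

/-- `HasRank T q n`: the rank of `q` relative to `T` is defined and equals `n`. -/
def HasRank {Q : Type u} [PartialOrder Q] (T : Set Q) (q : Q) (n : ℕ) : Prop :=
  IsLeast {m : ℕ | ∃ φ : LTerm T, Corresponds φ q ∧ φ.complexity = m} n

end FreeLat

namespace FreeLat

open Set

/-! ### Joins and meets in one step of the chain -/

section Step

variable {P : Type u} [PartialOrder P]

/-! Each step of the chain adds exactly the joins and meets of non-empty finite subsets of the
previous poset. Such bounds exist in the amalgamation (generated ideals and filters), and every
element of it is one of them. So, by induction, terms of complexity at most `n` over `P` have values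
in `A_n`, and every element of `A_n` is such a value.

The obstacle is that `γ_n` preserves a join or meet only if the set belongs to the specification;
other bounds may be lost. The induction therefore carries `StablyCorresponds`, where every bound in
the evaluation is a specified one. The specifications of `A_{n+1}` contain all non-empty finite
subsets of `γ_n[A_n]`, so the images of evaluated sets are specified again, and stable values
survive every later step and the passage to the colimit (`preservesSpec_mu`).

The induction is `exists_stablyCorresponds` and `exists_lterm_stablyCorresponds`. A map that
preserves the specified bounds turns it into statements on correspondents: the identity gives the
claims on `A_n`, and `μ_n` those on the colimit. Since a term has at most one correspondent, rank
and first stage of appearance agree. -/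

theorem exists_fgIdeal_of_finite (U : Set (Set P)) {S : Set P} (hS : S.Finite)
    (hne : S.Nonempty) : ∃ y : FGIdeal U, IsLUB (eY U '' S) y := by
  have hI : IsLeast {J | IsUIdeal U J ∧ S ⊆ J} (⋂₀ {J | IsUIdeal U J ∧ S ⊆ J}) := by
    refine ⟨⟨⟨?_, ?_⟩, ?_⟩, fun J hJ => sInter_subset_of_mem hJ⟩
    · exact isLowerSet_sInter fun J hJ => hJ.1.1
    · intro V hV hVs a ha J hJ
      exact hJ.1.2 V hV (hVs.trans (sInter_subset_of_mem hJ)) a ha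
    · exact subset_sInter fun J hJ => hJ.2
  refine ⟨⟨_, hne.mono hI.1.2, S, hS, hI⟩, ?_, ?_⟩
  · rintro _ ⟨p, hp, rfl⟩ q hq
    exact hI.1.1.1 hq (hI.1.2 hp)
  · intro z hz
    obtain ⟨R, _, hR⟩ := z.fg
    exact hI.2 ⟨hR.1.1, fun p hp => hz ⟨p, hp, rfl⟩ (show p ≤ p from le_rfl)⟩

theorem exists_fgFilter_of_finite (D : Set (Set P)) {S : Set P} (hS : S.Finite)
    (hne : S.Nonempty) : ∃ x : FGFilter D, IsGLB (eX D '' S) x := by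
  have hI : IsLeast {J | IsDFilter D J ∧ S ⊆ J} (⋂₀ {J | IsDFilter D J ∧ S ⊆ J}) := by
    refine ⟨⟨⟨?_, ?_⟩, ?_⟩, fun J hJ => sInter_subset_of_mem hJ⟩
    · exact isUpperSet_sInter fun J hJ => hJ.1.1
    · intro V hV hVs a ha J hJ
      exact hJ.1.2 V hV (hVs.trans (sInter_subset_of_mem hJ)) a ha
    · exact subset_sInter fun J hJ => hJ.2
  refine ⟨⟨_, hne.mono hI.1.2, S, hS, hI⟩, ?_, ?_⟩
  · rintro _ ⟨p, hp, rfl⟩ q hq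
    exact hI.1.1.1 hq (hI.1.2 hp)
  · intro z hz
    obtain ⟨R, _, hR⟩ := z.fg
    exact hI.2 ⟨hR.1.1, fun p hp => hz ⟨p, hp, rfl⟩ (show p ≤ p from le_rfl)⟩

theorem FGIdeal.exists_isLUB_image {U : Set (Set P)} (y : FGIdeal U) :
    ∃ S : Set P, S.Finite ∧ S.Nonempty ∧ IsLUB (eY U '' S) y := by
  obtain ⟨S, hS, hl⟩ := y.fg
  obtain ⟨a, ha⟩ := y.nonempty
  -- The generating set may be empty even though the ideal is not (when `∅ ∈ U`). Adding an element
  -- of the ideal makes it non-empty without changing the ideal generated.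
  refine ⟨insert a S, hS.insert a, insert_nonempty a S, ?_, ?_⟩
  · rintro _ ⟨p, hp, rfl⟩ q hq
    exact hl.1.1.1 hq (insert_subset ha hl.1.2 hp)
  · intro z hz
    obtain ⟨R, _, hR⟩ := z.fg
    exact hl.2 ⟨hR.1.1, fun p hp => hz ⟨p, Or.inr hp, rfl⟩ (show p ≤ p from le_rfl)⟩

theorem FGFilter.exists_isGLB_image {D : Set (Set P)} (x : FGFilter D) :
    ∃ S : Set P, S.Finite ∧ S.Nonempty ∧ IsGLB (eX D '' S) x := by
  obtain ⟨S, hS, hl⟩ := x.fg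
  obtain ⟨a, ha⟩ := x.nonempty
  refine ⟨insert a S, hS.insert a, insert_nonempty a S, ?_, ?_⟩
  · rintro _ ⟨p, hp, rfl⟩ q hq
    exact hl.1.1.1 hq (insert_subset ha hl.1.2 hp)
  · intro z hz
    obtain ⟨R, _, hR⟩ := z.fg
    exact hl.2 ⟨hR.1.1, fun p hp => hz ⟨p, Or.inr hp, rfl⟩ (show p ≤ p from le_rfl)⟩

/-- A `U`-ideal that contains `S` must contain the join of `S`, hence the whole principal ideal of
that join. -/
theorem isLUB_eY {U : Set (Set P)} {S : Set P} (hS : S ∈ U) {a : P} (ha : IsLUB S a) :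
    IsLUB (eY U '' S) (eY U a) := by
  refine ⟨(eY U).monotone.mem_upperBounds_image ha.1, fun z hz => ?_⟩
  obtain ⟨R, _, hR⟩ := z.fg
  have haz : a ∈ z.carrier :=
    hR.1.1.2 S hS (fun p hp => hz ⟨p, hp, rfl⟩ (show p ≤ p from le_rfl)) a ha
  exact fun q hq => hR.1.1.1 hq haz

theorem isGLB_eX {D : Set (Set P)} {S : Set P} (hS : S ∈ D) {a : P} (ha : IsGLB S a) :
    IsGLB (eX D '' S) (eX D a) := by
  refine ⟨(eX D).monotone.mem_lowerBounds_image ha.1, fun z hz => ?_⟩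
  obtain ⟨R, _, hR⟩ := z.fg
  have haz : a ∈ z.carrier :=
    hR.1.1.2 S hS (fun p hp => hz ⟨p, hp, rfl⟩ (show p ≤ p from le_rfl)) a ha
  exact fun q hq => hR.1.1.1 hq haz

end Step

/-! ### Transfer from ideals and filters to the amalgamation -/

section Amalgam

variable (A : SpecPoset.{u})

theorem SpecPoset.gamma_image_eq_piY (S : Set A.carrier) :
    A.amalg.gamma '' S = A.amalg.piY '' (eY A.U '' S) := by
  rw [image_image]
  exact image_congr fun p _ => A.amalg.comm p

theorem SpecPoset.gamma_image_eq_piX (S : Set A.carrier) :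
    A.amalg.gamma '' S = A.amalg.piX '' (eX A.D '' S) := by
  rw [image_image]
  rfl

variable {A}

theorem SpecPoset.isLUB_gamma {S : Set A.carrier} (hS : S ∈ A.U) {a : A.carrier}
    (ha : IsLUB S a) : IsLUB (A.amalg.gamma '' S) (A.amalg.gamma a) := by
  rw [A.gamma_image_eq_piY, show A.amalg.gamma a = A.amalg.piY (eY A.U a) from A.amalg.comm a]
  exact A.amalg.map_isLUB _ _ (isLUB_eY hS ha)

theorem SpecPoset.isGLB_gamma {S : Set A.carrier} (hS : S ∈ A.D) {a : A.carrier}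
    (ha : IsGLB S a) : IsGLB (A.amalg.gamma '' S) (A.amalg.gamma a) := by
  rw [A.gamma_image_eq_piX]
  exact A.amalg.map_isGLB _ _ (isGLB_eX hS ha)

theorem SpecPoset.exists_isLUB_gamma {S : Set A.carrier} (hS : S.Finite) (hne : S.Nonempty) :
    ∃ q, IsLUB (A.amalg.gamma '' S) q := by
  obtain ⟨y, hy⟩ := exists_fgIdeal_of_finite A.U hS hne
  rw [A.gamma_image_eq_piY]
  exact ⟨_, A.amalg.map_isLUB _ _ hy⟩

theorem SpecPoset.exists_isGLB_gamma {S : Set A.carrier} (hS : S.Finite) (hne : S.Nonempty) :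
    ∃ q, IsGLB (A.amalg.gamma '' S) q := by
  obtain ⟨y, hy⟩ := exists_fgFilter_of_finite A.D hS hne
  rw [A.gamma_image_eq_piX]
  exact ⟨_, A.amalg.map_isGLB _ _ hy⟩

/-- The amalgamation is a quotient of the disjoint union of filters and ideals, so `q` comes from
one of them. A filter is a finite meet of principal filters and an ideal a finite join of principal
ideals; `piX` and `piY` preserve these. -/
theorem SpecPoset.isLUB_or_isGLB_gamma (q : A.amalg.carrier) :
    ∃ S : Set A.carrier, S.Finite ∧ S.Nonempty ∧
      (IsLUB (A.amalg.gamma '' S) q ∨ IsGLB (A.amalg.gamma '' S) q) := by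
  obtain ⟨x, rfl⟩ | ⟨y, rfl⟩ : (∃ x, A.amalg.piX x = q) ∨ ∃ y, A.amalg.piY y = q := by
    induction q using Quotient.inductionOn with | _ a
    rcases a with x | y
    · exact Or.inl ⟨x, rfl⟩
    · exact Or.inr ⟨y, rfl⟩
  · obtain ⟨S, hS, hne, h⟩ := x.exists_isGLB_image
    refine ⟨S, hS, hne, Or.inr ?_⟩
    rw [A.gamma_image_eq_piX]
    exact A.amalg.map_isGLB _ _ h
  · obtain ⟨S, hS, hne, h⟩ := y.exists_isLUB_image
    refine ⟨S, hS, hne, Or.inl ?_⟩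
    rw [A.gamma_image_eq_piY]
    exact A.amalg.map_isLUB _ _ h

end Amalgam

/-! ### Terms -/

/-- Substitution of variables in a term. -/
def LTerm.map {S T : Type u} (h : S → T) : LTerm S → LTerm T
  | .var t => .var (h t)
  | .join n hn φ => .join n hn fun i => (φ i).map h
  | .meet n hn φ => .meet n hn fun i => (φ i).map h

theorem LTerm.complexity_map {S T : Type u} (h : S → T) (φ : LTerm S) :
    (φ.map h).complexity = φ.complexity := by
  induction φ with
  | var t => rfl
  | join n hn φ ih => simp only [map, complexity, ih]
  | meet n hn φ ih => simp only [map, complexity, ih]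

/-- Joins and meets are unique when they exist, so an evaluation has no freedom. -/
theorem Corresponds.unique {Q : Type u} [PartialOrder Q] {T : Set Q} {φ : LTerm T} :
    ∀ {q q' : Q}, Corresponds φ q → Corresponds φ q' → q = q' := by
  induction φ with
  | var t => exact fun h h' => Eq.trans h (Eq.symm h')
  | join n hn φ ih =>
    rintro q q' ⟨r, hr, hq⟩ ⟨r', hr', hq'⟩
    obtain rfl : r = r' := funext fun i => ih i (hr i) (hr' i)
    exact hq.unique hq'
  | meet n hn φ ih =>
    rintro q q' ⟨r, hr, hq⟩ ⟨r', hr', hq'⟩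
    obtain rfl : r = r' := funext fun i => ih i (hr i) (hr' i)
    exact hq.unique hq'

/-- `StablyCorresponds f φ q`: the element `q` is the value of the term `φ`, its variables being
interpreted by `f`, and only joins of members of `A.U` and meets of members of `A.D` are used in
the evaluation. -/
def StablyCorresponds {A : SpecPoset.{u}} {T : Type u} (f : T → A.carrier) :
    LTerm T → A.carrier → Prop
  | .var t, q => q = f t
  | .join n _ φ, q => ∃ r : Fin n → A.carrier, (∀ i, StablyCorresponds f (φ i) (r i)) ∧
      range r ∈ A.U ∧ IsLUB (range r) q
  | .meet n _ φ, q => ∃ r : Fin n → A.carrier, (∀ i, StablyCorresponds f (φ i) (r i)) ∧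
      range r ∈ A.D ∧ IsGLB (range r) q

theorem stablyCorresponds_map {A : SpecPoset.{u}} {S T : Type u} (h : S → T)
    (f : T → A.carrier) (φ : LTerm S) : ∀ q : A.carrier,
    StablyCorresponds f (φ.map h) q ↔ StablyCorresponds (f ∘ h) φ q := by
  induction φ with
  | var t => exact fun _ => Iff.rfl
  | join n hn φ ih => intro q; simp only [LTerm.map, StablyCorresponds, ih]
  | meet n hn φ ih => intro q; simp only [LTerm.map, StablyCorresponds, ih]

/-- This also serves for meets, since both specifications of `A.next` are the same set. -/
theorem gamma_image_mem_next {A : SpecPoset.{u}} {S : Set A.carrier} (hS : S.Finite)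
    (hne : S.Nonempty) : A.amalg.gamma '' S ∈ A.next.U :=
  ⟨hne.image _, hS.image _, image_subset_range _ _⟩

theorem range_fin_nonempty {α : Type u} {n : ℕ} (hn : 2 ≤ n) (r : Fin n → α) :
    (range r).Nonempty :=
  ⟨_, ⟨0, by omega⟩, rfl⟩

/-- Specified bounds are preserved by `γ`, and their images are specified in `A.next`; this second
fact lets the argument be iterated. -/
theorem StablyCorresponds.next {A : SpecPoset.{u}} {T : Type u} {f : T → A.carrier}
    {φ : LTerm T} : ∀ {q : A.carrier}, StablyCorresponds f φ q →
      StablyCorresponds (A := A.next) (A.amalg.gamma ∘ f) φ (A.amalg.gamma q) := by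
  induction φ with
  | var t => exact fun h => congrArg A.amalg.gamma h
  | join n hn φ ih =>
    rintro q ⟨r, hr, hU, hq⟩
    have hmem := gamma_image_mem_next (finite_range r) (range_fin_nonempty hn r)
    have hq' := SpecPoset.isLUB_gamma hU hq
    rw [← range_comp] at hmem hq'
    exact ⟨_, fun i => ih i (hr i), hmem, hq'⟩
  | meet n hn φ ih =>
    rintro q ⟨r, hr, hU, hq⟩
    have hmem := gamma_image_mem_next (finite_range r) (range_fin_nonempty hn r)
    have hq' := SpecPoset.isGLB_gamma hU hq
    rw [← range_comp] at hmem hq'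
    exact ⟨_, fun i => ih i (hr i), hmem, hq'⟩

/-- `m` preserves the joins and meets of the non-empty finite members of the specifications. -/
def PreservesSpec (A : SpecPoset.{u}) {Q : Type u} [PartialOrder Q] (m : A.carrier → Q) : Prop :=
  ∀ S : Set A.carrier, S.Finite → S.Nonempty → ∀ a,
    (S ∈ A.U → IsLUB S a → IsLUB (m '' S) (m a)) ∧ (S ∈ A.D → IsGLB S a → IsGLB (m '' S) (m a))

theorem preservesSpec_id (A : SpecPoset.{u}) : PreservesSpec A (id : A.carrier → A.carrier) := by
  intro S _ _ a
  simp

theorem StablyCorresponds.corresponds {A : SpecPoset.{u}} {Q : Type u} [PartialOrder Q]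
    {T : Set Q} {m : A.carrier → Q} (hm : PreservesSpec A m) {f : T → A.carrier}
    (hf : ∀ t, m (f t) = t) {φ : LTerm T} :
    ∀ {q : A.carrier}, StablyCorresponds f φ q → Corresponds φ (m q) := by
  induction φ with
  | var t => exact fun h => (congrArg m h).trans (hf t)
  | join n hn φ ih =>
    rintro q ⟨r, hr, hU, hq⟩
    refine ⟨m ∘ r, fun i => ih i (hr i), ?_⟩
    rw [range_comp]
    exact (hm _ (finite_range r) (range_fin_nonempty hn r) q).1 hU hq
  | meet n hn φ ih =>
    rintro q ⟨r, hr, hU, hq⟩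
    refine ⟨m ∘ r, fun i => ih i (hr i), ?_⟩
    rw [range_comp]
    exact (hm _ (finite_range r) (range_fin_nonempty hn r) q).2 hU hq

theorem exists_range_fin_eq {α : Type u} {S : Set α} (hS : S.Finite) (hne : S.Nonempty) :
    ∃ k, 2 ≤ k ∧ ∃ r : Fin k → α, range r = S := by
  obtain ⟨a, ha⟩ := hne
  obtain ⟨s, rfl⟩ := hS.exists_finset_coe
  -- Term arities start at 2, so an element is repeated to cover singletons.
  refine ⟨(a :: a :: s.toList).length, by simp, (a :: a :: s.toList).get, ?_⟩
  rw [range_list_get]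
  ext x
  simp only [List.mem_cons, Finset.mem_toList, mem_ofPred_eq, Finset.mem_coe]
  constructor
  · rintro (rfl | rfl | h)
    exacts [ha, ha, h]
  · exact fun h => Or.inr (Or.inr h)

/-! ### Correspondents in the chain -/

section Chain

variable {P : Type u} [PartialOrder P] {U D : Set (Set P)}

theorem exists_stablyCorresponds (n : ℕ) : ∀ φ : LTerm P, φ.complexity ≤ n →
    ∃ q : Approx U D n, StablyCorresponds (gammaZero U D n) φ q := by
  induction n with
  | zero =>
    rintro (t | ⟨k, hk, φ⟩ | ⟨k, hk, φ⟩) h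
    · exact ⟨_, rfl⟩
    · simp [LTerm.complexity] at h
    · simp [LTerm.complexity] at h
  | succ n ih =>
    rintro (t | ⟨k, hk, φ⟩ | ⟨k, hk, φ⟩) h
    · exact ⟨_, rfl⟩
    -- The arguments are evaluated one stage earlier. Their values form a non-empty finite set,
    -- whose bound exists one stage later and is specified there.
    all_goals
      have hφ : ∀ i, (φ i).complexity ≤ n := fun i =>
        (Finset.le_sup (f := fun i => (φ i).complexity) (Finset.mem_univ i)).trans
          (Nat.le_of_succ_le_succ h)
      choose r hr using fun i => ih (φ i) (hφ i)
      have hne := range_fin_nonempty hk r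
      have hfin := finite_range r
      have hmem := gamma_image_mem_next hfin hne
    · obtain ⟨q, hq⟩ := SpecPoset.exists_isLUB_gamma hfin hne
      rw [← range_comp] at hq hmem
      exact ⟨q, _, fun i => (hr i).next, hmem, hq⟩
    · obtain ⟨q, hq⟩ := SpecPoset.exists_isGLB_gamma hfin hne
      rw [← range_comp] at hq hmem
      exact ⟨q, _, fun i => (hr i).next, hmem, hq⟩

theorem exists_lterm_stablyCorresponds (n : ℕ) : ∀ q : Approx U D n,
    ∃ φ : LTerm P, φ.complexity ≤ n ∧ StablyCorresponds (gammaZero U D n) φ q := by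
  induction n with
  | zero => exact fun q => ⟨.var q, le_rfl, rfl⟩
  | succ n ih =>
    intro q
    obtain ⟨S, hS, hne, hq⟩ := SpecPoset.isLUB_or_isGLB_gamma (A := stage U D n) q
    obtain ⟨k, hk, r, rfl⟩ := exists_range_fin_eq hS hne
    choose φ hφ hr using fun i => ih (r i)
    have hmem := gamma_image_mem_next hS hne
    have hc : (Finset.univ.sup fun i => (φ i).complexity) + 1 ≤ n + 1 :=
      Nat.succ_le_succ (Finset.sup_le fun i _ => hφ i)
    rw [← range_comp] at hq hmem
    rcases hq with hq | hq
    · exact ⟨.join k hk φ, hc, _, fun i => (hr i).next, hmem, hq⟩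
    · exact ⟨.meet k hk φ, hc, _, fun i => (hr i).next, hmem, hq⟩

variable {Q : Type u} [PartialOrder Q] {n : ℕ} {m : Approx U D n → Q} {T : Set Q}

theorem exists_corresponds (hm : PreservesSpec (stage U D n) m)
    (hT : T = range (m ∘ gammaZero U D n)) (φ : LTerm T) (hφ : φ.complexity ≤ n) :
    ∃ q, Corresponds φ (m q) := by
  -- Variables are pulled back to `P`, where the stable evaluation takes place.
  have hg : ∀ t : T, ∃ p, m (gammaZero U D n p) = t := fun t => hT.le t.2
  choose g hg using hg
  obtain ⟨q, hq⟩ := exists_stablyCorresponds (U := U) (D := D) n (φ.map g)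
    ((φ.complexity_map g).trans_le hφ)
  rw [stablyCorresponds_map] at hq
  exact ⟨q, hq.corresponds hm hg⟩

theorem exists_lterm_corresponds (hm : PreservesSpec (stage U D n) m)
    (hinj : Function.Injective m) (hT : T = range (m ∘ gammaZero U D n)) (q : Approx U D n) :
    ∃ φ : LTerm T, φ.complexity ≤ n ∧ Corresponds φ (m q) := by
  subst hT
  obtain ⟨φ, hφ, hq⟩ := exists_lterm_stablyCorresponds n q
  choose g hg using fun t : range (m ∘ gammaZero U D n) => t.2
  refine ⟨φ.map (rangeFactorization (m ∘ gammaZero U D n)), (φ.complexity_map _).trans_le hφ,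
    StablyCorresponds.corresponds hm (f := gammaZero U D n ∘ g) hg ?_⟩
  rw [stablyCorresponds_map]
  convert hq using 1
  -- The chosen preimages are known to be right only after applying `m`; injectivity removes it.
  exact funext fun p => hinj (hg (rangeFactorization (m ∘ gammaZero U D n) p))

end Chain

theorem exists_hasRank_le {Q : Type u} [PartialOrder Q] {T : Set Q} {q : Q} {n : ℕ}
    {φ : LTerm T} (hφ : φ.complexity ≤ n) (hq : Corresponds φ q) : ∃ m ≤ n, HasRank T q m := by
  classical
  have h : ∃ m, ∃ φ : LTerm T, Corresponds φ q ∧ φ.complexity = m := ⟨_, φ, hq, rfl⟩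
  exact ⟨Nat.find h, (Nat.find_min' h ⟨φ, hq, rfl⟩).trans hφ, Nat.find_spec h,
    fun k hk => Nat.find_min' h hk⟩

/-! ### The colimit -/

section Colimit

open CategoryTheory CategoryTheory.Limits

variable {P : Type u} [PartialOrder P] {U D : Set (Set P)} (c : Cocone (chain U D))

theorem mu_gamma (n : ℕ) (q : Approx U D n) : mu c (n + 1) (gamma U D n q) = mu c n q := by
  have hmap : (chain U D).map (homOfLE (Nat.le_add_right n 1)) = gamma U D n :=
    Functor.ofSequence_map_homOfLE_succ (X := fun n => PosE.mk (Approx U D n)) (gamma U D) n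
  have h := c.w (homOfLE (Nat.le_add_right n 1))
  rw [hmap] at h
  exact DFunLike.congr_fun (F := Approx U D n ↪o c.pt.carrier) h q

theorem mu_gammaZero (n : ℕ) (p : P) : mu c n (gammaZero U D n p) = mu c 0 p := by
  induction n with
  | zero => rfl
  | succ n ih => exact (mu_gamma c n _).trans ih

theorem exists_mu_add (n : ℕ) (q : Approx U D n) (k : ℕ) :
    ∃ q' : Approx U D (n + k), mu c (n + k) q' = mu c n q := by
  induction k with
  | zero => exact ⟨q, rfl⟩
  | succ k ih =>
    obtain ⟨q', h⟩ := ih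
    exact ⟨gamma U D (n + k) q', (mu_gamma c _ _).trans h⟩

/-- The subposet of the vertex of a cocone that consists of the images of the `A_n`. -/
def imageCocone : Cocone (chain U D) where
  pt := PosE.mk {q : c.pt.carrier // ∃ (n : ℕ) (q' : Approx U D n), mu c n q' = q}
  ι :=
    { app := fun n => show Approx U D n ↪o _ from OrderEmbedding.ofMapLEIff
        (fun q => ⟨mu c n q, n, q, rfl⟩) fun _ _ => (mu c n).le_iff_le
      naturality := fun n m h => by
        refine RelEmbedding.ext fun q => Subtype.ext ?_
        exact DFunLike.congr_fun (F := Approx U D n ↪o c.pt.carrier) (c.w h) q }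

/-- The union of the images of the `A_n` is itself a cocone. The induced map into it, followed by
the inclusion, agrees with the identity on every `μ_n`, hence is the identity; so the union is
everything. -/
theorem exists_mu_eq (hc : IsColimit c) (q : c.pt.carrier) :
    ∃ (n : ℕ) (q' : Approx U D n), mu c n q' = q := by
  let i : (imageCocone c).pt.carrier ↪o c.pt.carrier := OrderEmbedding.subtype _
  let d : c.pt.carrier ↪o (imageCocone c).pt.carrier := hc.desc (imageCocone c)
  have h : hc.desc (imageCocone c) ≫ (show (imageCocone c).pt ⟶ c.pt from i) = 𝟙 c.pt := by
    refine hc.hom_ext fun n => ?_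
    rw [← Category.assoc, hc.fac, Category.comp_id]
    rfl
  have hq : i (d q) = q :=
    DFunLike.congr_fun (F := c.pt.carrier ↪o c.pt.carrier) h q
  rw [← hq]
  exact (d q).2

/-- The specified join is pushed up the chain until it reaches the stage of `b`, where the
comparison is the defining property of a join. The equation `m = n + k` keeps the stage of `b` fixed
while `n` grows. -/
theorem mu_le_of_mem_upperBounds (k : ℕ) : ∀ (n m : ℕ) (_ : m = n + k)
    (S : Set (Approx U D n)) (_ : S.Finite) (_ : S.Nonempty) (a : Approx U D n)
    (_ : S ∈ (stage U D n).U) (_ : IsLUB S a) (b : Approx U D m)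
    (_ : ∀ s ∈ S, mu c n s ≤ mu c m b), mu c n a ≤ mu c m b := by
  induction k with
  | zero =>
    rintro n m hm S _ _ a _ ha b hb
    obtain rfl : m = n := hm
    exact (mu c m).monotone (ha.2 fun s hs => (mu c m).le_iff_le.1 (hb s hs))
  | succ k ih =>
    rintro n m hm S hS hne a hU ha b hb
    rw [← mu_gamma c n a]
    refine ih (n + 1) m (by omega) (gamma U D n '' S) (hS.image _) (hne.image _) _
      (gamma_image_mem_next hS hne) (SpecPoset.isLUB_gamma hU ha) b ?_
    rintro _ ⟨s, hs, rfl⟩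
    rw [mu_gamma]
    exact hb s hs

theorem le_mu_of_mem_lowerBounds (k : ℕ) : ∀ (n m : ℕ) (_ : m = n + k)
    (S : Set (Approx U D n)) (_ : S.Finite) (_ : S.Nonempty) (a : Approx U D n)
    (_ : S ∈ (stage U D n).D) (_ : IsGLB S a) (b : Approx U D m)
    (_ : ∀ s ∈ S, mu c m b ≤ mu c n s), mu c m b ≤ mu c n a := by
  induction k with
  | zero =>
    rintro n m hm S _ _ a _ ha b hb
    obtain rfl : m = n := hm
    exact (mu c m).monotone (ha.2 fun s hs => (mu c m).le_iff_le.1 (hb s hs))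
  | succ k ih =>
    rintro n m hm S hS hne a hD ha b hb
    rw [← mu_gamma c n a]
    refine ih (n + 1) m (by omega) (gamma U D n '' S) (hS.image _) (hne.image _) _
      (gamma_image_mem_next hS hne) (SpecPoset.isGLB_gamma hD ha) b ?_
    rintro _ ⟨s, hs, rfl⟩
    rw [mu_gamma]
    exact hb s hs

theorem preservesSpec_mu (hc : IsColimit c) (n : ℕ) : PreservesSpec (stage U D n) (mu c n) := by
  intro S hS hne a
  refine ⟨fun hU ha => ⟨(mu c n).monotone.mem_upperBounds_image ha.1, fun b hb => ?_⟩,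
    fun hD ha => ⟨(mu c n).monotone.mem_lowerBounds_image ha.1, fun b hb => ?_⟩⟩
  all_goals
    obtain ⟨m, b, rfl⟩ := exists_mu_eq c hc b
    -- The bound is moved to stage `m + n`, so that its stage is not before `n`.
    obtain ⟨b', hb'⟩ := exists_mu_add c m b n
    rw [← hb'] at hb ⊢
  · exact mu_le_of_mem_upperBounds c m n _ (Nat.add_comm m n) S hS hne a hU ha b'
      fun s hs => hb ⟨s, hs, rfl⟩
  · exact le_mu_of_mem_lowerBounds c m n _ (Nat.add_comm m n) S hS hne a hD ha b'
      fun s hs => hb ⟨s, hs, rfl⟩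

theorem range_mu_zero (n : ℕ) : range (mu c 0) = range (mu c n ∘ gammaZero U D n) :=
  congrArg range (funext fun p => (mu_gammaZero c n p).symm)

end Colimit

theorem isLeast_iff_of_cofinal {s t : Set ℕ} (hst : ∀ a ∈ s, a ∈ t)
    (hts : ∀ b ∈ t, ∃ a ∈ s, a ≤ b) (n : ℕ) : IsLeast s n ↔ IsLeast t n := by
  constructor
  · rintro ⟨hn, hl⟩
    refine ⟨hst n hn, fun b hb => ?_⟩
    obtain ⟨a, ha, hab⟩ := hts b hb
    exact (hl ha).trans hab
  · rintro ⟨hn, hl⟩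
    obtain ⟨a, ha, han⟩ := hts n hn
    obtain rfl : a = n := le_antisymm han (hl (hst a ha))
    exact ⟨ha, fun b hb => hl (hst b hb)⟩

end FreeLat

theorem proposition9 {P : Type u} [PartialOrder P] (U D : Set (Set P))
    (hU : FreeLat.IsJoinSpec U) (hD : FreeLat.IsMeetSpec D)
    (hUr : FreeLat.RadiusLeOmega U) (hDr : FreeLat.RadiusLeOmega D) :
    (∀ n : ℕ, 1 ≤ n →
      (∀ q : FreeLat.Approx U D n,
        ∃ m ≤ n, FreeLat.HasRank (Set.range (FreeLat.gammaZero U D n)) q m) ∧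
      FreeLat.IsCompleteRelTo ((n + 1 : ℕ) : ℕ∞) (Set.range (FreeLat.gammaZero U D n))) ∧
    ∀ c : CategoryTheory.Limits.Cocone (FreeLat.chain U D),
      Nonempty (CategoryTheory.Limits.IsColimit c) →
      (∀ q : c.pt.carrier, ∃ m, FreeLat.HasRank (Set.range (FreeLat.mu c 0)) q m) ∧
      FreeLat.IsCompleteRelTo ⊤ (Set.range (FreeLat.mu c 0)) ∧
      ∀ (q : c.pt.carrier) (n : ℕ),
        FreeLat.HasRank (Set.range (FreeLat.mu c 0)) q n ↔
          IsLeast {m : ℕ | ∃ q' : FreeLat.Approx U D m, FreeLat.mu c m q' = q} n := by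
  open FreeLat in
  refine ⟨fun n _ => ⟨fun q => ?_, fun φ hφ => ?_⟩, ?_⟩
  · obtain ⟨φ, hφ, hq⟩ := exists_lterm_corresponds (preservesSpec_id (stage U D n))
      Function.injective_id rfl q
    exact exists_hasRank_le hφ hq
  · obtain ⟨q, hq⟩ := exists_corresponds (preservesSpec_id (stage U D n)) rfl φ
      (Nat.lt_succ_iff.1 (Nat.cast_lt.1 hφ))
    exact ⟨q, hq⟩
  · rintro c ⟨hc⟩
    have hterm : ∀ (m : ℕ) (q' : Approx U D m), ∃ φ : LTerm (Set.range (mu c 0)),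
        φ.complexity ≤ m ∧ Corresponds φ (mu c m q') := fun m =>
      exists_lterm_corresponds (preservesSpec_mu c hc m) (mu c m).injective (range_mu_zero c m)
    have hcorr : ∀ φ : LTerm (Set.range (mu c 0)),
        ∃ q' : Approx U D φ.complexity, Corresponds φ (mu c φ.complexity q') := fun φ =>
      exists_corresponds (preservesSpec_mu c hc _) (range_mu_zero c _) φ le_rfl
    -- Complexities of terms for `q` are compared with stages containing `q`. Every such complexity
    -- is such a stage, and every such stage bounds some such complexity from above, so the minima
    -- agree.
    refine ⟨fun q => ?_, fun φ _ => ?_, fun q n => isLeast_iff_of_cofinal ?_ ?_ n⟩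
    · obtain ⟨m, q', rfl⟩ := exists_mu_eq c hc q
      obtain ⟨φ, hφ, hq⟩ := hterm m q'
      obtain ⟨k, _, hk⟩ := exists_hasRank_le hφ hq
      exact ⟨k, hk⟩
    · obtain ⟨q', hq⟩ := hcorr φ
      exact ⟨_, hq⟩
    · rintro _ ⟨φ, hφ, rfl⟩
      obtain ⟨q', hq⟩ := hcorr φ
      exact ⟨q', hq.unique hφ⟩
    · rintro b ⟨q', rfl⟩
      obtain ⟨φ, hφ, hq⟩ := hterm b q'
      exact ⟨_, ⟨φ, hq, rfl⟩, hφ⟩
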